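/- For $\gamma,\delta\in\mathbb{C}$ with $\gamma\neq 0$ let $$F_{\gamma,\delta}(z)=\frac{\gamma z}{z^{2}+\delta z+1},$$ a quadratic rational map of the Riemann sphere $\widehat{\mathbb{C}}=\mathbb{C}\cup\{\infty\}$. A periodic point $\zeta$ of least period $n$ of a rational map $g$ is called attracting if the eigenvalue of $g^{n}$ at $\zeta$ has modulus less than $1$. The basin of its cycle $\langle\zeta\rangle=\{\zeta,g(\zeta),\dots,g^{n-1}(\zeta)\}$ is the set of all $w\in\widehat{\mathbb{C}}$ whose forward orbit $g^{j}(w)$ converges to $\langle\zeta\rangle$ as $j\to\infty$, and the immediate basin of $\zeta$ is the connected component of this basin that contains $\zeta$. Let $\gamma_k\in\mathbb{C}\setminus\{0\}$ and $\delta_k\in\mathbb{C}$ be sequences with $\gamma_k\to\infty$, let $F_k=F_{\gamma_k,\delta_k}$, fix an integer $n>1$, and for each $k$ let $z_k\in\widehat{\mathbb{C}}$ be an attracting periodic point of $F_k$ of least period $n$ with immediate basin $B_k$. If $z_k\to 0$, then $B_k\to 0$: for every neighbourhood $U$ of $0$ one has $B_k\subseteq U$ for all sufficiently large $k$. -/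

import Mathlib

open Filter Topology

/-! The Riemann sphere is `OnePoint ℂ`, the one-point compactification of `ℂ`. -/

namespace QuadRat

open Classical in
/-- The quadratic rational map `F_{γ,δ}(z) = γ z / (z² + δ z + 1)` of the Riemann sphere (`γ ≠ 0`):
it sends `∞` to `0` and the zeros of the denominator to `∞`. -/
noncomputable def F (γ δ : ℂ) : OnePoint ℂ → OnePoint ℂ
  | OnePoint.infty => ((0 : ℂ) : OnePoint ℂ)
  | OnePoint.some z =>
      if z ^ 2 + δ * z + 1 = 0 then OnePoint.infty
      else ((γ * z / (z ^ 2 + δ * z + 1) : ℂ) : OnePoint ℂ)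

open Classical in
/-- The inversion `z ↦ 1 / z` of the Riemann sphere, exchanging `0` and `∞`. -/
noncomputable def inversion : OnePoint ℂ → OnePoint ℂ
  | OnePoint.infty => ((0 : ℂ) : OnePoint ℂ)
  | OnePoint.some z => if z = 0 then OnePoint.infty else ((z⁻¹ : ℂ) : OnePoint ℂ)

/-- The affine coordinate on the Riemann sphere. The value at `∞` is immaterial: the coordinate is
only used near finite points. -/
def affineCoord : OnePoint ℂ → ℂ
  | OnePoint.infty => 0
  | OnePoint.some z => z

/-- `ρ` is the eigenvalue (complex derivative, in the coordinate `z` at a finite point and in the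
coordinate `1 / z` at `∞`) of the map `g` at its fixed point `ζ`. -/
def HasEigenvalueAt (g : OnePoint ℂ → OnePoint ℂ) (ζ : OnePoint ℂ) (ρ : ℂ) : Prop :=
  match ζ with
  | OnePoint.infty =>
      HasDerivAt (fun w : ℂ => affineCoord (inversion (g (inversion (w : OnePoint ℂ))))) ρ 0
  | OnePoint.some z => HasDerivAt (fun w : ℂ => affineCoord (g (w : OnePoint ℂ))) ρ z

/-- `ζ` is an attracting periodic point of `g` of (least) period `n ≥ 1`: the eigenvalue of `g^n`
at `ζ` has modulus less than `1`. -/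
def IsAttractingPeriodicPt (g : OnePoint ℂ → OnePoint ℂ) (n : ℕ) (ζ : OnePoint ℂ) : Prop :=
  0 < n ∧ Function.minimalPeriod g ζ = n ∧ ∃ ρ : ℂ, HasEigenvalueAt g^[n] ζ ρ ∧ ‖ρ‖ < 1

/-- The forward orbit of `ζ`; for a periodic point this is its cycle. -/
def cycleOf (g : OnePoint ℂ → OnePoint ℂ) (ζ : OnePoint ℂ) : Set (OnePoint ℂ) :=
  Set.range fun j : ℕ => g^[j] ζ

/-- The basin of the cycle of `ζ`: all points whose forward orbit converges to that cycle, that is,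
eventually stays in any given neighbourhood of the cycle. -/
def basin (g : OnePoint ℂ → OnePoint ℂ) (ζ : OnePoint ℂ) : Set (OnePoint ℂ) :=
  {w | Tendsto (fun j : ℕ => g^[j] w) atTop (𝓝ˢ (cycleOf g ζ))}

/-- The immediate basin of `ζ`: the connected component, containing `ζ`, of the basin of the cycle
of `ζ`. -/
def immediateBasin (g : OnePoint ℂ → OnePoint ℂ) (ζ : OnePoint ℂ) : Set (OnePoint ℂ) :=
  connectedComponentIn (basin g ζ) ζ

end QuadRat

/-! A closed disc about 0 that contains the attracting point contains its whole immediate basin as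
soon as `F^n` maps no point of the boundary circle into the disc: the points whose `F^n`-orbit stays
in the disc then form a relatively clopen part of the basin (`immediateBasin_subset_of_trapping`).
It remains to find arbitrarily small circles that escape in this sense.

Write γ = s² and d = δ/s. Along an ultrafilter, d tends to ∞ or to some d₀. If d → ∞, iterates of
the annulus 4/|δ| ≤ |z| ≤ |δ|/4 stay in a smaller annulus on which `F` contracts, so its only
periodic points are fixed. As n > 1, the attracting point lies inside the circle |z| = 4/|δ|, and
this circle escapes (`immediateBasin_subset_of_large`).

If d → d₀, then in the coordinate w = z/s the map tends to the Möbius map w ↦ 1/(w + d₀) away from w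
= 0, and a fixed circle shrinks to w = 0. As long as the Möbius orbit of 0 avoids 0, iterates of the
circle have size at least of order |s|. If 0 returns first at time q, then `F^q` is close to z ↦ z +
1/z + T. For T → T₀ a small circle is thrown far out by 1/z, and at most n returns cannot bring it
back; for T → ∞ the m-th return grows like mT. The remaining n mod q steps, if any, lead out to
scale s (`exists_radius_escape`). -/

namespace QuadRat

open Bornology

/-! ### Topology of the Riemann sphere and continuity of `F` -/

theorem tendsto_infty_of_norm {α : Type*} {l : Filter α} {f : α → OnePoint ℂ}
    (h : ∀ R : ℝ, ∀ᶠ a in l, ∀ v : ℂ, f a = (v : OnePoint ℂ) → R < ‖v‖) :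
    Tendsto f l (𝓝 OnePoint.infty) := by
  rw [OnePoint.nhds_infty_eq, coclosedCompact_eq_cocompact, ← Metric.cobounded_eq_cocompact]
  intro S hS
  rw [mem_sup, mem_map, mem_pure] at hS
  obtain ⟨R, -, hR⟩ := (hasBasis_cobounded_norm (E := ℂ)).mem_iff.1 hS.1
  rw [mem_map]
  filter_upwards [h R] with a ha
  rw [Set.mem_preimage]
  cases hfa : f a with
  | infty => exact hS.2
  | coe v => exact hR (ha v hfa).le

theorem F_coe_of_ne {γ δ z : ℂ} (h : z ^ 2 + δ * z + 1 ≠ 0) :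
    F γ δ (z : OnePoint ℂ) = ((γ * z / (z ^ 2 + δ * z + 1) : ℂ) : OnePoint ℂ) :=
  if_neg h

theorem F_coe_of_eq {γ δ z : ℂ} (h : z ^ 2 + δ * z + 1 = 0) :
    F γ δ (z : OnePoint ℂ) = OnePoint.infty :=
  if_pos h

theorem F_infty (γ δ : ℂ) : F γ δ OnePoint.infty = ((0 : ℂ) : OnePoint ℂ) := rfl

theorem F_coe_inv {γ δ z : ℂ} (hz : z ≠ 0) (h : z + δ + z⁻¹ ≠ 0) :
    F γ δ (z : OnePoint ℂ) = ((γ / (z + δ + z⁻¹) : ℂ) : OnePoint ℂ) := by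
  have e : z ^ 2 + δ * z + 1 = z * (z + δ + z⁻¹) := by
    field_simp
  rw [F_coe_of_ne (by rw [e]; exact mul_ne_zero hz h), e]
  congr 1
  field_simp

theorem continuous_F {γ : ℂ} (hγ : γ ≠ 0) (δ : ℂ) : Continuous (F γ δ) := by
  rw [continuous_iff_continuousAt]
  intro x
  cases x with
  | infty =>
    rw [OnePoint.continuousAt_infty', F_infty, coclosedCompact_eq_cocompact,
      ← Metric.cobounded_eq_cocompact]
    have h1 : Tendsto (fun z : ℂ => δ + z⁻¹) (cobounded ℂ) (𝓝 (δ + 0)) :=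
      tendsto_const_nhds.add tendsto_inv₀_cobounded
    have h2 : Tendsto (fun z : ℂ => z + (δ + z⁻¹)) (cobounded ℂ) (cobounded ℂ) := by
      rw [← tendsto_norm_atTop_iff_cobounded]
      refine tendsto_atTop_mono' _ ?_
        (tendsto_atTop_add_const_right _ (-(‖δ‖ + 1)) tendsto_norm_cobounded_atTop)
      filter_upwards [h1.norm.eventually_lt_const (by simp : ‖δ + 0‖ < ‖δ‖ + 1)] with z hz
      have := norm_sub_le (z + (δ + z⁻¹)) (δ + z⁻¹)
      rw [add_sub_cancel_right] at this
      linarith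
    have h3 : Tendsto (fun z : ℂ => γ * (z + (δ + z⁻¹))⁻¹) (cobounded ℂ) (𝓝 (γ * 0)) :=
      tendsto_const_nhds.mul (tendsto_inv₀_cobounded.comp h2)
    rw [mul_zero] at h3
    have h4 := (OnePoint.continuous_coe.tendsto (0 : ℂ)).comp h3
    refine h4.congr' ?_
    filter_upwards [eventually_ne_cobounded (0 : ℂ), h2.eventually (eventually_ne_cobounded (0 : ℂ))]
      with z hz hz'
    rw [Function.comp_apply, Function.comp_apply, F_coe_inv hz (by rwa [add_assoc]), add_assoc,
      div_eq_mul_inv]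
  | coe z =>
    rw [OnePoint.continuousAt_coe]
    have hden : Tendsto (fun w : ℂ => w ^ 2 + δ * w + 1) (𝓝 z) (𝓝 (z ^ 2 + δ * z + 1)) :=
      Continuous.tendsto (by fun_prop) z
    have hnum : Tendsto (fun w : ℂ => γ * w) (𝓝 z) (𝓝 (γ * z)) :=
      Continuous.tendsto (by fun_prop) z
    by_cases h : z ^ 2 + δ * z + 1 = 0
    · have hz : z ≠ 0 := by
        rintro rfl
        simp at h
      rw [ContinuousAt, Function.comp_apply, F_coe_of_eq h]
      refine tendsto_infty_of_norm fun R => ?_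
      rw [h] at hden
      have h1 : Tendsto (fun w : ℂ => R * ‖w ^ 2 + δ * w + 1‖) (𝓝 z) (𝓝 0) := by
        simpa using hden.norm.const_mul R
      filter_upwards [h1.eventually_lt hnum.norm (norm_pos_iff.2 (mul_ne_zero hγ hz))] with w hw v hv
      rw [Function.comp_apply] at hv
      by_cases hw0 : w ^ 2 + δ * w + 1 = 0
      · rw [F_coe_of_eq hw0] at hv
        exact absurd hv (OnePoint.infty_ne_coe v)
      · rw [F_coe_of_ne hw0, OnePoint.coe_eq_coe] at hv
        rw [← hv, norm_div, lt_div_iff₀ (norm_pos_iff.2 hw0)]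
        exact hw
    · have h1 := (OnePoint.continuous_coe.tendsto _).comp (hnum.div hden h)
      rw [ContinuousAt, Function.comp_apply, F_coe_of_ne h]
      refine h1.congr' ?_
      filter_upwards [hden.eventually_ne h] with w hw
      rw [Function.comp_apply, Function.comp_apply, F_coe_of_ne hw]
      rfl

/-! ### Trapping the immediate basin -/

/-- On a small disc, `h` shrinks the distance to `z` by a factor `c` with ‖ρ‖ < c < 1. The
uniformity of `J₀` over `V` is what later controls all large times at once. -/
theorem exists_uniform_attraction {h : OnePoint ℂ → OnePoint ℂ} (hh : Continuous h) {z ρ : ℂ}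
    (hz : h z = z) (hρ : HasDerivAt (fun w : ℂ => affineCoord (h w)) ρ z) (hρ1 : ‖ρ‖ < 1) :
    ∃ V : Set (OnePoint ℂ), IsOpen V ∧ (z : OnePoint ℂ) ∈ V ∧
      ∀ O ∈ 𝓝 (z : OnePoint ℂ), ∃ J₀ : ℕ, ∀ J ≥ J₀, ∀ x ∈ V, h^[J] x ∈ O := by
  obtain ⟨c, hc, hc1⟩ := exists_between hρ1
  have hc0 : 0 ≤ c := (norm_nonneg ρ).trans hc.le
  -- The derivative only sees `affineCoord`, whose value at ∞ is a dummy 0, so ∞ is excluded by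
  -- continuity.
  have hfin : ∀ᶠ w : ℂ in 𝓝 z, h w ≠ OnePoint.infty := by
    have : Tendsto (fun w : ℂ => h w) (𝓝 z) (𝓝 (z : OnePoint ℂ)) := by
      have := (hh.comp OnePoint.continuous_coe).tendsto z
      rwa [Function.comp_apply, hz] at this
    exact this.eventually_ne (OnePoint.coe_ne_infty z)
  have hlip := (hasDerivAt_iff_isLittleO.1 hρ).def (sub_pos.2 hc)
  obtain ⟨s, hs, hsub⟩ := Metric.eventually_nhds_iff_ball.1 (hfin.and hlip)
  have step : ∀ w ∈ Metric.ball z s, ∃ v : ℂ, h w = v ∧ ‖v - z‖ ≤ c * ‖w - z‖ := by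
    intro w hw
    obtain ⟨h1, h2⟩ := hsub w hw
    obtain ⟨v, hv⟩ := OnePoint.ne_infty_iff_exists.1 h1
    refine ⟨v, hv.symm, ?_⟩
    rw [← hv, hz] at h2
    change ‖v - z - (w - z) • ρ‖ ≤ _ at h2
    have h3 := norm_add_le (v - z - (w - z) • ρ) ((w - z) • ρ)
    rw [sub_add_cancel, norm_smul] at h3
    linarith
  have iter : ∀ J : ℕ, ∀ w ∈ Metric.ball z s, ∃ v : ℂ, h^[J] w = v ∧ ‖v - z‖ ≤ c ^ J * ‖w - z‖ := by
    intro J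
    induction J with
    | zero => exact fun w _ => ⟨w, rfl, by simp⟩
    | succ J ih =>
      intro w hw
      obtain ⟨v, hv, hvz⟩ := ih w hw
      have hvs : v ∈ Metric.ball z s := by
        rw [mem_ball_iff_norm] at hw ⊢
        exact (hvz.trans (mul_le_of_le_one_left (norm_nonneg _) (pow_le_one₀ hc0 hc1.le))).trans_lt hw
      obtain ⟨v', hv', hvz'⟩ := step v hvs
      refine ⟨v', by rw [Function.iterate_succ_apply', hv, hv'], hvz'.trans ?_⟩
      rw [pow_succ', mul_assoc]
      exact mul_le_mul_of_nonneg_left hvz hc0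
  refine ⟨(↑) '' Metric.ball z s, OnePoint.isOpenEmbedding_coe.isOpenMap _ Metric.isOpen_ball,
    ⟨z, Metric.mem_ball_self hs, rfl⟩, fun O hO => ?_⟩
  obtain ⟨t, ht, htO⟩ := Metric.mem_nhds_iff.1
    (OnePoint.continuous_coe.continuousAt.preimage_mem_nhds hO : ((↑) : ℂ → OnePoint ℂ) ⁻¹' O ∈ 𝓝 z)
  have hlim : Tendsto (fun J : ℕ => c ^ J * s) atTop (𝓝 0) := by
    simpa using (tendsto_pow_atTop_nhds_zero_of_lt_one hc0 hc1).mul_const s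
  obtain ⟨J₀, hJ₀⟩ := eventually_atTop.1 (hlim.eventually_lt_const ht)
  refine ⟨J₀, fun J hJ x hx => ?_⟩
  obtain ⟨w, hw, rfl⟩ := hx
  obtain ⟨v, hv, hvz⟩ := iter J w hw
  rw [hv]
  refine htO ?_
  rw [mem_ball_iff_norm] at hw ⊢
  exact (hvz.trans (mul_le_mul_of_nonneg_left hw.le (pow_nonneg hc0 J))).trans_lt (hJ₀ J hJ)

/-- If no point of the boundary of the closed set `N` is mapped into `N` by `g^n`, then `N` contains
the immediate basin of each attracting point of period `n` that it contains. -/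
theorem immediateBasin_subset_of_trapping {g : OnePoint ℂ → OnePoint ℂ} (hg : Continuous g) {n : ℕ}
    (hn : 0 < n) {z ρ : ℂ} {N : Set (OnePoint ℂ)} (hN : IsClosed N) (hzN : (z : OnePoint ℂ) ∈ N)
    (hz : g^[n] z = z) (hρ : HasDerivAt (fun w : ℂ => affineCoord (g^[n] w)) ρ z) (hρ1 : ‖ρ‖ < 1)
    (hfr : ∀ y ∈ N, g^[n] y ∈ N → y ∈ interior N) : immediateBasin g z ⊆ N := by
  have hh : Continuous g^[n] := hg.iterate n
  obtain ⟨V, hVo, hzV, hV⟩ := exists_uniform_attraction hh hz hρ hρ1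
  set h := g^[n] with hdef
  have hpow : ∀ j, h^[j] = g^[n * j] := fun j => (Function.iterate_mul g n j).symm
  have hzfix : ∀ j, h^[j] z = z := fun j => Function.iterate_fixed hz j
  let K : Set (OnePoint ℂ) := {y | ∀ j, h^[j] y ∈ N}
  have hKclosed : IsClosed K := by
    have : K = ⋂ j, h^[j] ⁻¹' N := by
      ext y
      simp [K]
    rw [this]
    exact isClosed_iInter fun j => hN.preimage (hh.iterate j)
  have hKint : ∀ y ∈ K, ∀ j, h^[j] y ∈ interior N := fun y hy j =>
    hfr _ (hy j) (by
      have := hy (j + 1)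
      rwa [Function.iterate_succ_apply'] at this)
  have hzK : (z : OnePoint ℂ) ∈ K := fun j => by rwa [hzfix]
  -- The orbit of `y` enters `V` at some time `a`, after which the `h`-orbit converges to a fixed
  -- point of `h` on the cycle. That point is in `N`, hence in its interior by `hfr`. Nearby orbits
  -- stay in `N` at late times by uniform attraction, and at the finitely many earlier times by
  -- continuity.
  have hopen : ∀ y ∈ K, y ∈ basin g z → y ∈ interior K := by
    intro y hyK hyB
    obtain ⟨a, ha⟩ : ∃ a, g^[a] y ∈ V := by
      have hW : (⋃ i : ℕ, g^[i] ⁻¹' V) ∈ 𝓝ˢ (cycleOf g z) := by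
        refine (isOpen_iUnion fun i => hVo.preimage (hg.iterate i)).mem_nhdsSet.2 ?_
        rintro _ ⟨m, rfl⟩
        refine Set.mem_iUnion.2 ⟨n * m - m, ?_⟩
        rw [Set.mem_preimage, ← Function.iterate_add_apply,
          Nat.sub_add_cancel (Nat.le_mul_of_pos_left m hn), ← hpow, hzfix]
        exact hzV
      have hyB' : Tendsto (fun j : ℕ => g^[j] y) atTop (𝓝ˢ (cycleOf g z)) := hyB
      obtain ⟨j, hj⟩ := (hyB'.eventually hW).exists
      obtain ⟨i, hi⟩ := Set.mem_iUnion.1 hj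
      exact ⟨i + j, by rwa [Function.iterate_add_apply]⟩
    -- The orbit enters `V` under `g`, not under `h`; `b` further steps of `g` complete `a` to a
    -- multiple of `n`.
    set b := n * a - a with hb
    have hsplit : ∀ J x, h^[a + J] x = g^[b] (h^[J] (g^[a] x)) := by
      intro J x
      rw [hpow, hpow, ← Function.iterate_add_apply, ← Function.iterate_add_apply]
      congr 1
      have := Nat.le_mul_of_pos_left a hn
      rw [mul_add]
      omega
    have hlim : Tendsto (fun J => h^[a + J] y) atTop (𝓝 (g^[b] z)) := by
      simp only [hsplit]
      refine ((hg.iterate b).tendsto _).comp fun O hO => ?_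
      obtain ⟨J₀, hJ₀⟩ := hV O hO
      exact mem_map.2 (mem_atTop_sets.2 ⟨J₀, fun J hJ => hJ₀ J hJ _ ha⟩)
    have hpN : g^[b] z ∈ N := hN.mem_of_tendsto hlim (Eventually.of_forall fun J => hyK _)
    have hpint : g^[b] z ∈ interior N := by
      refine hfr _ hpN ?_
      rwa [hdef, ← Function.iterate_add_apply, add_comm, Function.iterate_add_apply, ← hdef, hz]
    obtain ⟨J₀, hJ₀⟩ := hV (g^[b] ⁻¹' interior N)
      ((hg.iterate b).continuousAt.preimage_mem_nhds (isOpen_interior.mem_nhds hpint))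
    have hfinite : ∀ᶠ x in 𝓝 y, ∀ j ∈ Finset.range (a + J₀), h^[j] x ∈ interior N :=
      (Finset.eventually_all _).2 fun j _ =>
        (hh.iterate j).continuousAt.preimage_mem_nhds (isOpen_interior.mem_nhds (hKint y hyK j))
    have hlate : ∀ᶠ x in 𝓝 y, g^[a] x ∈ V :=
      (hg.iterate a).continuousAt.preimage_mem_nhds (hVo.mem_nhds ha)
    rw [mem_interior_iff_mem_nhds]
    filter_upwards [hfinite, hlate] with x hx hxV j
    refine interior_subset ?_
    by_cases hj : j < a + J₀
    · exact hx j (Finset.mem_range.2 hj)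
    · obtain ⟨J, rfl⟩ : ∃ J, j = a + J := ⟨j - a, by omega⟩
      rw [hsplit]
      exact hJ₀ J (by omega) _ hxV
  by_cases hzB : (z : OnePoint ℂ) ∈ basin g z
  · have hsub : immediateBasin g z ⊆ interior K := by
      -- By `hopen`, the open sets `interior K` and `Kᶜ` cover the basin, so they cannot separate
      -- the component.
      refine isPreconnected_connectedComponentIn.subset_left_of_subset_union isOpen_interior
        hKclosed.isOpen_compl ?_ ?_ ⟨z, mem_connectedComponentIn hzB, hopen _ hzK hzB⟩
      · exact Set.disjoint_left.2 fun x hx hx' => hx' (interior_subset hx)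
      · intro x hx
        by_cases hxK : x ∈ K
        · exact Or.inl (hopen x hxK (connectedComponentIn_subset _ _ hx))
        · exact Or.inr hxK
    exact fun x hx => interior_subset (hsub hx) 0
  · rw [immediateBasin, connectedComponentIn_eq_empty hzB]
    exact Set.empty_subset N

theorem immediateBasin_subset_closedBall {γ δ : ℂ} (hγ : γ ≠ 0) {n : ℕ} {z : ℂ} {r : ℝ}
    (hattr : IsAttractingPeriodicPt (F γ δ) n z) (hz : ‖z‖ ≤ r)
    (hesc : ∀ y v : ℂ, ‖y‖ = r → ‖v‖ ≤ r → (F γ δ)^[n] y ≠ v) :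
    immediateBasin (F γ δ) z ⊆ (↑) '' Metric.closedBall (0 : ℂ) r := by
  obtain ⟨hn, hper, ρ, hρ, hρ1⟩ := hattr
  have hcl : IsClosed (((↑) : ℂ → OnePoint ℂ) '' Metric.closedBall (0 : ℂ) r) :=
    ((isCompact_closedBall (0 : ℂ) r).image OnePoint.continuous_coe).isClosed
  have hfix : (F γ δ)^[n] z = z := by
    rw [← hper]
    exact Function.isPeriodicPt_minimalPeriod _ _
  refine immediateBasin_subset_of_trapping (continuous_F hγ δ) hn hcl
    ⟨z, mem_closedBall_zero_iff.2 hz, rfl⟩ hfix hρ hρ1 ?_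
  rintro _ ⟨y, hy, rfl⟩ ⟨v, hv, hyv⟩
  have hlt : ‖y‖ < r := lt_of_le_of_ne (mem_closedBall_zero_iff.1 hy) fun h =>
    hesc y v h (mem_closedBall_zero_iff.1 hv) hyv.symm
  exact interior_maximal (Set.image_mono Metric.ball_subset_closedBall)
    (OnePoint.isOpenEmbedding_coe.isOpenMap _ Metric.isOpen_ball)
    ⟨y, mem_ball_zero_iff.2 hlt, rfl⟩

/-! ### The far annulus: `|δ|² ≫ |γ|` -/

/-- Here `z` and `z⁻¹` each have modulus at most |δ|/4, so δ dominates the denominator. -/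
theorem F_mem_annulus {γ δ z : ℂ} (hδ : 0 < ‖δ‖) (h1 : 4 / ‖δ‖ ≤ ‖z‖) (h2 : ‖z‖ ≤ ‖δ‖ / 4) :
    ‖δ‖ / 2 ≤ ‖z + δ + z⁻¹‖ ∧ ‖z + δ + z⁻¹‖ ≤ 3 * ‖δ‖ / 2 ∧
      F γ δ (z : OnePoint ℂ) = ((γ / (z + δ + z⁻¹) : ℂ) : OnePoint ℂ) := by
  have hz : 0 < ‖z‖ := (by positivity : 0 < 4 / ‖δ‖).trans_le h1
  have hinv : ‖z⁻¹‖ ≤ ‖δ‖ / 4 := by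
    rw [norm_inv]
    refine (inv_anti₀ (by positivity) h1).trans_eq ?_
    rw [inv_div]
  have h3 : ‖z + z⁻¹‖ ≤ ‖δ‖ / 2 := (norm_add_le _ _).trans (by linarith)
  have h4 : z + δ + z⁻¹ = δ + (z + z⁻¹) := by ring
  have h5 : ‖δ‖ / 2 ≤ ‖z + δ + z⁻¹‖ := by
    have := norm_sub_le (z + δ + z⁻¹) (z + z⁻¹)
    rw [show z + δ + z⁻¹ - (z + z⁻¹) = δ by ring] at this
    linarith
  refine ⟨h5, ?_, F_coe_inv (norm_pos_iff.1 hz) (norm_pos_iff.1 (by linarith))⟩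
  rw [h4]
  exact (norm_add_le _ _).trans (by linarith)

/-- The annulus into which `F` maps `4 / |δ| ≤ |z| ≤ |δ| / 4`. -/
def imageAnnulus (γ δ : ℂ) : Set ℂ :=
  {v | 2 * ‖γ‖ / (3 * ‖δ‖) ≤ ‖v‖ ∧ ‖v‖ ≤ 2 * ‖γ‖ / ‖δ‖}

theorem exists_F_eq_mem_imageAnnulus {γ δ z : ℂ} (hδ : 0 < ‖δ‖) (h1 : 4 / ‖δ‖ ≤ ‖z‖)
    (h2 : ‖z‖ ≤ ‖δ‖ / 4) : ∃ v ∈ imageAnnulus γ δ, F γ δ (z : OnePoint ℂ) = v := by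
  obtain ⟨h3, h4, h5⟩ := F_mem_annulus (γ := γ) hδ h1 h2
  refine ⟨_, ⟨?_, ?_⟩, h5⟩
  · rw [norm_div, show 2 * ‖γ‖ / (3 * ‖δ‖) = ‖γ‖ / (3 * ‖δ‖ / 2) by field_simp]
    exact div_le_div_of_nonneg_left (norm_nonneg _) (by linarith) h4
  · rw [norm_div, show 2 * ‖γ‖ / ‖δ‖ = ‖γ‖ / (‖δ‖ / 2) by field_simp]
    exact div_le_div_of_nonneg_left (norm_nonneg _) (by linarith) h3

theorem bounds_of_mem_imageAnnulus {γ δ v : ℂ} (hγ : 36 ≤ ‖γ‖) (hδ : 0 < ‖δ‖)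
    (hγδ : 8 * ‖γ‖ ≤ ‖δ‖ ^ 2) (hv : v ∈ imageAnnulus γ δ) :
    4 / ‖δ‖ < ‖v‖ ∧ ‖v‖ ≤ ‖δ‖ / 4 := by
  constructor
  · refine lt_of_lt_of_le ?_ hv.1
    rw [div_lt_div_iff₀ hδ (by positivity)]
    nlinarith
  · refine hv.2.trans ?_
    rw [div_le_div_iff₀ hδ (by norm_num)]
    nlinarith

theorem exists_iterate_eq_mem_imageAnnulus {γ δ z : ℂ} (hγ : 36 ≤ ‖γ‖) (hδ : 0 < ‖δ‖)
    (hγδ : 8 * ‖γ‖ ≤ ‖δ‖ ^ 2) (h1 : 4 / ‖δ‖ ≤ ‖z‖) (h2 : ‖z‖ ≤ ‖δ‖ / 4) (j : ℕ) :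
    ∃ v ∈ imageAnnulus γ δ, (F γ δ)^[j + 1] (z : OnePoint ℂ) = v := by
  induction j with
  | zero => exact exists_F_eq_mem_imageAnnulus hδ h1 h2
  | succ j ih =>
    obtain ⟨v, hv, hj⟩ := ih
    obtain ⟨h3, h4⟩ := bounds_of_mem_imageAnnulus hγ hδ hγδ hv
    rw [Function.iterate_succ_apply', hj]
    exact exists_F_eq_mem_imageAnnulus hδ h3.le h4

/-- The exact difference quotient is estimated using |v|, |w| ≥ 2|γ|/(3|δ|). The constants 8 and 36
give 1/8 + 1/16 = 3/4 · 1/4 in `hfac`. -/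
theorem F_contracting_on_imageAnnulus {γ δ v w v' w' : ℂ} (hγ : 36 ≤ ‖γ‖) (hδ : 0 < ‖δ‖)
    (hγδ : 8 * ‖γ‖ ≤ ‖δ‖ ^ 2) (hv : v ∈ imageAnnulus γ δ) (hw : w ∈ imageAnnulus γ δ)
    (hv' : F γ δ (v : OnePoint ℂ) = v') (hw' : F γ δ (w : OnePoint ℂ) = w') :
    ‖v' - w'‖ ≤ 3 / 4 * ‖v - w‖ := by
  obtain ⟨hv1, hv2⟩ := bounds_of_mem_imageAnnulus hγ hδ hγδ hv
  obtain ⟨hw1, hw2⟩ := bounds_of_mem_imageAnnulus hγ hδ hγδ hw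
  obtain ⟨hv3, -, hv4⟩ := F_mem_annulus (γ := γ) hδ hv1.le hv2
  obtain ⟨hw3, -, hw4⟩ := F_mem_annulus (γ := γ) hδ hw1.le hw2
  rw [hv', OnePoint.coe_eq_coe] at hv4
  rw [hw', OnePoint.coe_eq_coe] at hw4
  have hpos : 0 < 4 / ‖δ‖ := by positivity
  have hv0 : v ≠ 0 := norm_pos_iff.1 (hpos.trans hv1)
  have hw0 : w ≠ 0 := norm_pos_iff.1 (hpos.trans hw1)
  have hA : v + δ + v⁻¹ ≠ 0 := norm_pos_iff.1 (by linarith)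
  have hB : w + δ + w⁻¹ ≠ 0 := norm_pos_iff.1 (by linarith)
  have key : v' - w' = γ * ((w - v) * (1 - (v * w)⁻¹)) / ((v + δ + v⁻¹) * (w + δ + w⁻¹)) := by
    rw [hv4, hw4, div_sub_div _ _ hA hB]
    congr 1
    field_simp
    ring
  have hγ0 : 0 < ‖γ‖ := by linarith
  have hprod : 4 * ‖γ‖ ^ 2 / (9 * ‖δ‖ ^ 2) ≤ ‖v * w‖ := by
    rw [norm_mul]
    refine le_trans (le_of_eq ?_) (mul_le_mul hv.1 hw.1 (by positivity) (norm_nonneg v))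
    field_simp
    norm_num
  have hinv : ‖(v * w)⁻¹‖ ≤ 9 * ‖δ‖ ^ 2 / (4 * ‖γ‖ ^ 2) := by
    rw [norm_inv]
    refine (inv_anti₀ (by positivity) hprod).trans_eq ?_
    rw [inv_div]
  have hone : ‖1 - (v * w)⁻¹‖ ≤ 1 + 9 * ‖δ‖ ^ 2 / (4 * ‖γ‖ ^ 2) :=
    (norm_sub_le _ _).trans (by rw [norm_one]; linarith)
  have hden : ‖δ‖ ^ 2 / 4 ≤ ‖(v + δ + v⁻¹) * (w + δ + w⁻¹)‖ := by
    rw [norm_mul]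
    nlinarith
  have hfac : ‖γ‖ * (1 + 9 * ‖δ‖ ^ 2 / (4 * ‖γ‖ ^ 2)) ≤ 3 / 4 * (‖δ‖ ^ 2 / 4) := by
    have : ‖γ‖ * (1 + 9 * ‖δ‖ ^ 2 / (4 * ‖γ‖ ^ 2)) = ‖γ‖ + 9 * ‖δ‖ ^ 2 / (4 * ‖γ‖) := by
      field_simp
    rw [this]
    have h9 : 9 * ‖δ‖ ^ 2 / (4 * ‖γ‖) ≤ ‖δ‖ ^ 2 / 16 := by
      rw [div_le_div_iff₀ (by linarith) (by norm_num)]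
      nlinarith [sq_nonneg ‖δ‖]
    linarith
  rw [key, norm_div, div_le_iff₀ (norm_pos_iff.2 (mul_ne_zero hA hB)), norm_mul, norm_mul,
    norm_sub_rev w v]
  calc ‖γ‖ * (‖v - w‖ * ‖1 - (v * w)⁻¹‖)
      ≤ ‖γ‖ * (‖v - w‖ * (1 + 9 * ‖δ‖ ^ 2 / (4 * ‖γ‖ ^ 2))) := by gcongr
    _ = ‖v - w‖ * (‖γ‖ * (1 + 9 * ‖δ‖ ^ 2 / (4 * ‖γ‖ ^ 2))) := by ring
    _ ≤ ‖v - w‖ * (3 / 4 * (‖δ‖ ^ 2 / 4)) := by gcongr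
    _ = 3 / 4 * ‖v - w‖ * (‖δ‖ ^ 2 / 4) := by ring
    _ ≤ 3 / 4 * ‖v - w‖ * ‖(v + δ + v⁻¹) * (w + δ + w⁻¹)‖ := by gcongr

/-- The annulus `4 / |δ| ≤ |z| ≤ |δ| / 4` contains no periodic points but fixed points. -/
theorem isFixedPt_of_mem_annulus {γ δ z : ℂ} (hγ : 36 ≤ ‖γ‖) (hδ : 0 < ‖δ‖)
    (hγδ : 8 * ‖γ‖ ≤ ‖δ‖ ^ 2) (h1 : 4 / ‖δ‖ ≤ ‖z‖) (h2 : ‖z‖ ≤ ‖δ‖ / 4) {n : ℕ} (hn : 0 < n)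
    (hz : (F γ δ)^[n] (z : OnePoint ℂ) = z) : F γ δ (z : OnePoint ℂ) = z := by
  -- The sequence starts at `F z`, since contraction is known only on the image annulus. Consecutive
  -- differences shrink geometrically yet are `n`-periodic, hence vanish.
  choose v hv hvj using exists_iterate_eq_mem_imageAnnulus hγ hδ hγδ h1 h2
  have hstep : ∀ j, F γ δ (v j : OnePoint ℂ) = v (j + 1) := fun j => by
    rw [← hvj, ← hvj, ← Function.iterate_succ_apply' (F γ δ)]
  have hdist : ∀ j, ‖v j - v (j + 1)‖ ≤ (3 / 4) ^ j * ‖v 0 - v 1‖ := by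
    intro j
    induction j with
    | zero => simp
    | succ j ih =>
      have := F_contracting_on_imageAnnulus hγ hδ hγδ (hv j) (hv (j + 1)) (hstep j) (hstep (j + 1))
      rw [pow_succ']
      linarith
  have hper : ∀ j, v (j + n) = v j := fun j => by
    rw [← OnePoint.coe_eq_coe, ← hvj, ← hvj, show j + n + 1 = (j + 1) + n by ring,
      Function.iterate_add_apply, hz]
  have h0 : v 0 = v 1 := by
    have h3 := hdist n
    have e0 := hper 0
    have e1 := hper 1
    rw [zero_add] at e0
    rw [add_comm] at e1
    rw [e0, e1] at h3
    have h4 : (3 / 4 : ℝ) ^ n < 1 := pow_lt_one₀ (by norm_num) (by norm_num) hn.ne'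
    by_contra hne
    have : 0 < ‖v 0 - v 1‖ := norm_pos_iff.2 (sub_ne_zero.2 hne)
    nlinarith
  have hconst : ∀ j, v j = v 0 := by
    intro j
    induction j with
    | zero => rfl
    | succ j ih => rw [← OnePoint.coe_eq_coe, ← hstep, ih, hstep, ← h0]
  obtain ⟨m, rfl⟩ : ∃ m, n = m + 1 := ⟨n - 1, by omega⟩
  have hzv : (z : OnePoint ℂ) = v 0 := by rw [← hz, hvj, hconst]
  rw [hzv, hstep, ← h0]

theorem immediateBasin_subset_of_large {γ δ z : ℂ} {n : ℕ} (hn : 1 < n) (hγ : 36 ≤ ‖γ‖)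
    (hδ : 0 < ‖δ‖) (hγδ : 8 * ‖γ‖ ≤ ‖δ‖ ^ 2) (hz : ‖z‖ ≤ ‖δ‖ / 4)
    (hattr : IsAttractingPeriodicPt (F γ δ) n z) :
    immediateBasin (F γ δ) z ⊆ (↑) '' Metric.closedBall (0 : ℂ) (4 / ‖δ‖) := by
  have hγ0 : γ ≠ 0 := norm_pos_iff.1 (by linarith)
  have hfix : (F γ δ)^[n] z = z := by
    have := Function.isPeriodicPt_minimalPeriod (F γ δ) z
    rwa [hattr.2.1] at this
  refine immediateBasin_subset_closedBall hγ0 hattr ?_ ?_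
  · by_contra! hlt
    have h1 : Function.IsFixedPt (F γ δ) z :=
      isFixedPt_of_mem_annulus hγ hδ hγδ hlt.le hz (by omega) hfix
    have := hattr.2.1
    rw [Function.minimalPeriod_eq_one_iff_isFixedPt.2 h1] at this
    omega
  · intro y v hy hv hyv
    have h16 : 4 / ‖δ‖ ≤ ‖δ‖ / 4 := by
      rw [div_le_div_iff₀ hδ (by norm_num)]
      nlinarith
    obtain ⟨v', hv', hj⟩ := exists_iterate_eq_mem_imageAnnulus hγ hδ hγδ hy.ge (hy.trans_le h16) (n - 1)
    rw [Nat.sub_add_cancel (by omega), hyv, OnePoint.coe_eq_coe] at hj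
    have := (bounds_of_mem_imageAnnulus hγ hδ hγδ hv').1
    rw [← hj] at this
    linarith

/-! ### Continuants and orbits in projective coordinates -/

/-- The continuants `K_j(d)`: the `j`-th iterate of the Möbius map `w ↦ 1 / (w + d)` takes `0` to
`K_j(d) / K_{j+1}(d)`. -/
noncomputable def continuant (d : ℂ) : ℕ → ℂ
  | 0 => 0
  | 1 => 1
  | j + 2 => continuant d j + d * continuant d (j + 1)

theorem continuant_add_two (d : ℂ) (j : ℕ) :
    continuant d (j + 2) = continuant d j + d * continuant d (j + 1) := rfl

theorem continuous_continuant (j : ℕ) : Continuous fun d => continuant d j := by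
  induction j using Nat.twoStepInduction with
  | zero => exact continuous_const
  | one => exact continuous_const
  | more j h1 h2 => exact h1.add (continuous_id.mul h2)

/-- Projective coordinates of an orbit of `w ↦ 1 / (w + d + e / w)`. -/
noncomputable def orbitCoord (d e u : ℂ) : ℕ → ℂ
  | 0 => 1
  | 1 => u + d
  | j + 2 => orbitCoord d e u j + d * orbitCoord d e u (j + 1) +
      e * (orbitCoord d e u (j + 1) ^ 2 / orbitCoord d e u j)

/-- The coefficient of `e` in the deviation of `orbitCoord` from its value at `e = 0`. -/
noncomputable def orbitErr (d e u : ℂ) : ℕ → ℂ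
  | 0 => 0
  | 1 => 0
  | j + 2 => orbitErr d e u j + d * orbitErr d e u (j + 1) +
      orbitCoord d e u (j + 1) ^ 2 / orbitCoord d e u j

/-- The first-order form is needed because the return map multiplies these coordinates by `s`: with
e = s⁻², a bounded `orbitErr` then contributes only O(1/s). -/
theorem orbitCoord_eq (d e u : ℂ) (j : ℕ) :
    orbitCoord d e u j = continuant d (j + 1) + u * continuant d j + e * orbitErr d e u j := by
  induction j using Nat.twoStepInduction with
  | zero => simp [orbitCoord, orbitErr, continuant]
  | one => simp [orbitCoord, orbitErr, continuant, add_comm]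
  | more j h1 h2 =>
    have h2' : orbitCoord d e u (j + 1) =
      continuant d (j + 2) + u * continuant d (j + 1) + e * orbitErr d e u (j + 1) := h2
    have e1 : continuant d (j + 2 + 1) = continuant d (j + 1) + d * continuant d (j + 2) := rfl
    rw [orbitCoord, orbitErr, e1]
    linear_combination h1 + d * h2' - u * continuant_add_two d j

open Classical in
/-- The point of the sphere with projective coordinates `s x : y`. -/
noncomputable def projPt (s x y : ℂ) : OnePoint ℂ :=
  if y = 0 then OnePoint.infty else ((s * x / y : ℂ) : OnePoint ℂ)

theorem F_projPt {s d x y : ℂ} (hs : s ≠ 0) (hx : x ≠ 0) :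
    F (s ^ 2) (s * d) (projPt s x y) = projPt s y (x + d * y + (s ^ 2)⁻¹ * (y ^ 2 / x)) := by
  by_cases hy : y = 0
  · subst hy
    simp [projPt, F_infty, hx]
  · have hden : (s * x / y) ^ 2 + s * d * (s * x / y) + 1 =
        s ^ 2 * x / y ^ 2 * (x + d * y + (s ^ 2)⁻¹ * (y ^ 2 / x)) := by
      field_simp
    have hcoef : s ^ 2 * x / y ^ 2 ≠ 0 := by positivity
    rw [projPt, if_neg hy, projPt]
    split_ifs with h0
    · exact F_coe_of_eq (by rw [hden, h0, mul_zero])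
    · rw [F_coe_of_ne (by rw [hden]; exact mul_ne_zero hcoef h0), hden]
      congr 1
      field_simp

/-- The parameter u = (z + 1/z)/s absorbs the singular term e/w of the first step, so it is small
even though w = z/s is near 0. -/
theorem iterate_F_eq_projPt {s d z : ℂ} (hs : s ≠ 0) (hz : z ≠ 0) (j : ℕ)
    (hb : ∀ i < j, orbitCoord d (s ^ 2)⁻¹ ((z + z⁻¹) / s) i ≠ 0) :
    (F (s ^ 2) (s * d))^[j + 1] (z : OnePoint ℂ) =
      projPt s (orbitCoord d (s ^ 2)⁻¹ ((z + z⁻¹) / s) j)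
        (orbitCoord d (s ^ 2)⁻¹ ((z + z⁻¹) / s) (j + 1)) := by
  induction j with
  | zero =>
    have h := F_projPt (d := d) (y := 1) hs (div_ne_zero hz hs)
    rw [projPt, if_neg one_ne_zero, div_one, mul_div_cancel₀ z hs] at h
    rw [zero_add, Function.iterate_one, h]
    congr 1
    rw [orbitCoord]
    field_simp
    ring
  | succ j ih =>
    rw [Function.iterate_succ_apply', ih fun i hi => hb i (hi.trans j.lt_succ_self),
      F_projPt hs (hb j j.lt_succ_self), orbitCoord]

/-! ### Limits of orbits as `s → ∞` and `d → d₀` -/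

section Limits

variable {ι : Type*} {l : Filter ι} {d e u : ι → ℂ} {d₀ : ℂ}

theorem tendsto_orbitCoord_and_orbitErr (hd : Tendsto d l (𝓝 d₀)) (he : Tendsto e l (𝓝 0))
    (hu : Tendsto u l (𝓝 0)) (j : ℕ) (hc : ∀ i, 0 < i → i < j → continuant d₀ i ≠ 0) :
    Tendsto (fun k => orbitCoord (d k) (e k) (u k) j) l (𝓝 (continuant d₀ (j + 1))) ∧
      ∃ c, Tendsto (fun k => orbitErr (d k) (e k) (u k) j) l (𝓝 c) := by
  have hcont : ∀ i, Tendsto (fun k => continuant (d k) i) l (𝓝 (continuant d₀ i)) := fun i =>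
    ((continuous_continuant i).tendsto d₀).comp hd
  have coord_of_err : ∀ i c, Tendsto (fun k => orbitErr (d k) (e k) (u k) i) l (𝓝 c) →
      Tendsto (fun k => orbitCoord (d k) (e k) (u k) i) l (𝓝 (continuant d₀ (i + 1))) := by
    intro i c h
    simp only [orbitCoord_eq]
    simpa using ((hcont (i + 1)).add (hu.mul (hcont i))).add (he.mul h)
  induction j using Nat.twoStepInduction with
  | zero => exact ⟨coord_of_err 0 0 tendsto_const_nhds, 0, tendsto_const_nhds⟩
  | one => exact ⟨coord_of_err 1 0 tendsto_const_nhds, 0, tendsto_const_nhds⟩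
  | more j h1 h2 =>
    obtain ⟨hb1, c1, hc1⟩ := h1 fun i hi hij => hc i hi (by omega)
    obtain ⟨hb2, c2, hc2⟩ := h2 fun i hi hij => hc i hi (by omega)
    have h := (hc1.add (hd.mul hc2)).add ((hb2.pow 2).div hb1 (hc (j + 1) (by omega) (by omega)))
    exact ⟨coord_of_err _ _ h, _, h⟩

variable {s z : ι → ℂ}

theorem tendsto_inv_sq (hs : Tendsto s l (cobounded ℂ)) :
    Tendsto (fun k => (s k ^ 2)⁻¹) l (𝓝 0) := by
  have := (tendsto_inv₀_cobounded.comp hs).pow 2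
  simpa [Function.comp_def] using this

theorem eventually_iterate_F_eq_projPt (hs : Tendsto s l (cobounded ℂ)) (hd : Tendsto d l (𝓝 d₀))
    (hz : ∀ᶠ k in l, z k ≠ 0) (hu : Tendsto (fun k => (z k + (z k)⁻¹) / s k) l (𝓝 0)) {j : ℕ}
    (hc : ∀ i, 0 < i → i ≤ j → continuant d₀ i ≠ 0) :
    ∀ᶠ k in l, (F (s k ^ 2) (s k * d k))^[j + 1] (z k : OnePoint ℂ) =
      projPt (s k) (orbitCoord (d k) (s k ^ 2)⁻¹ ((z k + (z k)⁻¹) / s k) j)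
        (orbitCoord (d k) (s k ^ 2)⁻¹ ((z k + (z k)⁻¹) / s k) (j + 1)) := by
  have hne : ∀ᶠ k in l, ∀ i ∈ Finset.range j,
      orbitCoord (d k) (s k ^ 2)⁻¹ ((z k + (z k)⁻¹) / s k) i ≠ 0 := by
    refine (Finset.eventually_all _).2 fun i hi => ?_
    rw [Finset.mem_range] at hi
    exact (tendsto_orbitCoord_and_orbitErr hd (tendsto_inv_sq hs) hu i
      fun m hm hmi => hc m hm (by omega)).1.eventually_ne (hc (i + 1) (by omega) (by omega))
  filter_upwards [hne, hz, hs.eventually (eventually_ne_cobounded (0 : ℂ))] with k hk hzk hsk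
  exact iterate_F_eq_projPt hsk hzk j fun i hi => hk i (Finset.mem_range.2 hi)

/-- The iterate is `s` times a quotient whose numerator tends to K_t(d₀) ≠ 0 and whose denominator
stays bounded; K_{t+1}(d₀) may vanish. -/
theorem escape_of_continuant_ne_zero (hs : Tendsto s l (cobounded ℂ)) (hd : Tendsto d l (𝓝 d₀))
    (hz : ∀ᶠ k in l, z k ≠ 0) (hu : Tendsto (fun k => (z k + (z k)⁻¹) / s k) l (𝓝 0)) {t : ℕ}
    (ht : 0 < t) (hc : ∀ i, 0 < i → i ≤ t → continuant d₀ i ≠ 0) (r : ℝ) :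
    ∀ᶠ k in l, ∀ v : ℂ, ‖v‖ ≤ r →
      (F (s k ^ 2) (s k * d k))^[t] (z k : OnePoint ℂ) ≠ v := by
  obtain ⟨j, rfl⟩ : ∃ j, t = j + 1 := ⟨t - 1, by omega⟩
  have h1 := (tendsto_orbitCoord_and_orbitErr hd (tendsto_inv_sq hs) hu j
    fun i hi hij => hc i hi (by omega)).1
  have h2 := (tendsto_orbitCoord_and_orbitErr hd (tendsto_inv_sq hs) hu (j + 1)
    fun i hi hij => hc i hi (by omega)).1
  have h3 : Tendsto (fun k => r * ‖(s k)⁻¹ *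
      orbitCoord (d k) (s k ^ 2)⁻¹ ((z k + (z k)⁻¹) / s k) (j + 1)‖) l (𝓝 0) := by
    have := (((tendsto_inv₀_cobounded.comp hs).mul h2).norm).const_mul r
    simpa [Function.comp_def] using this
  filter_upwards [eventually_iterate_F_eq_projPt hs hd hz hu (j := j) fun i hi hij => hc i hi (by omega),
    h3.eventually_lt h1.norm (norm_pos_iff.2 (hc (j + 1) (by omega) le_rfl)),
    hs.eventually (eventually_ne_cobounded (0 : ℂ))] with k hk hlt hsk v hv hkv
  rw [hk, projPt] at hkv
  split_ifs at hkv with h0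
  · exact OnePoint.infty_ne_coe v hkv
  · rw [OnePoint.coe_eq_coe, div_eq_iff h0] at hkv
    have e1 : orbitCoord (d k) (s k ^ 2)⁻¹ ((z k + (z k)⁻¹) / s k) j =
        v * ((s k)⁻¹ * orbitCoord (d k) (s k ^ 2)⁻¹ ((z k + (z k)⁻¹) / s k) (j + 1)) := by
      rw [mul_left_comm, ← hkv]
      field_simp
    rw [e1, norm_mul v] at hlt
    exact absurd hlt (not_lt.2 (mul_le_mul_of_nonneg_right hv (norm_nonneg _)))

/-- When `0` has period `q = j + 2` under the limiting Möbius map, the `q`-th iterate of `F` is close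
to `z ↦ z + 1 / z + T` with `T = s K_q(d) / K_{q-1}(d₀)`. -/
theorem exists_return_map (hs : Tendsto s l (cobounded ℂ)) (hd : Tendsto d l (𝓝 d₀))
    (hz : ∀ᶠ k in l, z k ≠ 0) (hu : Tendsto (fun k => (z k + (z k)⁻¹) / s k) l (𝓝 0)) {j : ℕ}
    (hq : continuant d₀ (j + 2) = 0) (hc : ∀ i, 0 < i → i < j + 2 → continuant d₀ i ≠ 0) :
    ∃ z' κ μ η : ι → ℂ, Tendsto κ l (𝓝 1) ∧ Tendsto μ l (𝓝 1) ∧ Tendsto η l (𝓝 0) ∧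
      (∀ᶠ k in l, (F (s k ^ 2) (s k * d k))^[j + 2] (z k : OnePoint ℂ) = z' k) ∧
      ∀ᶠ k in l, z' k = κ k * (s k * continuant (d k) (j + 2) / continuant d₀ (j + 1)) +
        μ k * (z k + (z k)⁻¹) + η k := by
  have hlam : continuant d₀ (j + 1) ≠ 0 := hc _ (by omega) (by omega)
  have hnext : continuant d₀ (j + 2 + 1) = continuant d₀ (j + 1) := by
    rw [continuant_add_two d₀ (j + 1), hq, mul_zero, add_zero]
  obtain ⟨-, c, hc1⟩ := tendsto_orbitCoord_and_orbitErr hd (tendsto_inv_sq hs) hu (j + 1)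
    fun i hi hij => hc i hi (by omega)
  have h2 := (tendsto_orbitCoord_and_orbitErr hd (tendsto_inv_sq hs) hu (j + 2)
    fun i hi hij => hc i hi (by omega)).1
  rw [hnext] at h2
  have hcont : Tendsto (fun k => continuant (d k) (j + 1)) l (𝓝 (continuant d₀ (j + 1))) :=
    ((continuous_continuant (j + 1)).tendsto d₀).comp hd
  let B : ι → ℂ := fun k => orbitCoord (d k) (s k ^ 2)⁻¹ ((z k + (z k)⁻¹) / s k) (j + 2)
  let E : ι → ℂ := fun k => orbitErr (d k) (s k ^ 2)⁻¹ ((z k + (z k)⁻¹) / s k) (j + 1)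
  -- By `hnext`, `B` tends to K_{q+1}(d₀) = K_{q-1}(d₀), which makes `κ` and `μ` tend to 1.
  refine ⟨fun k => s k * orbitCoord (d k) (s k ^ 2)⁻¹ ((z k + (z k)⁻¹) / s k) (j + 1) / B k,
    fun k => continuant d₀ (j + 1) / B k, fun k => continuant (d k) (j + 1) / B k,
    fun k => (s k)⁻¹ * E k / B k, ?_, ?_, ?_, ?_, ?_⟩
  · have := (tendsto_const_nhds (x := continuant d₀ (j + 1))).div h2 hlam
    rwa [div_self hlam] at this
  · have := hcont.div h2 hlam
    rwa [div_self hlam] at this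
  · have := ((tendsto_inv₀_cobounded.comp hs).mul hc1).div h2 hlam
    rwa [zero_mul, zero_div] at this
  · filter_upwards [eventually_iterate_F_eq_projPt hs hd hz hu (j := j + 1)
      fun i hi hij => hc i hi (by omega), h2.eventually_ne hlam] with k hk hB
    rw [hk, projPt, if_neg hB]
  · filter_upwards [h2.eventually_ne hlam, hs.eventually (eventually_ne_cobounded (0 : ℂ))]
      with k hB hsk
    have hB' : B k ≠ 0 := hB
    change s k * orbitCoord (d k) (s k ^ 2)⁻¹ ((z k + (z k)⁻¹) / s k) (j + 1) / B k =
      continuant d₀ (j + 1) / B k * (s k * continuant (d k) (j + 2) / continuant d₀ (j + 1)) +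
        continuant (d k) (j + 1) / B k * (z k + (z k)⁻¹) + (s k)⁻¹ * E k / B k
    rw [orbitCoord_eq]
    change s k * (_ + _ + (s k ^ 2)⁻¹ * E k) / B k = _
    field_simp

end Limits

/-! ### Escape from small circles -/

section Return

variable {ι : Type*} {l : Filter ι} {s d y : ι → ℂ} {d₀ : ℂ} {j : ℕ}

theorem tendsto_add_inv_div_zero (hs : Tendsto s l (cobounded ℂ)) {z : ι → ℂ} {a : ℂ} (ha : a ≠ 0)
    (hz : Tendsto z l (𝓝 a)) : Tendsto (fun k => (z k + (z k)⁻¹) / s k) l (𝓝 0) := by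
  have := (hz.add (hz.inv₀ ha)).mul (tendsto_inv₀_cobounded.comp hs)
  rw [mul_zero] at this
  exact this

/-- The first return has limit of size about 1/r. While |L| ≥ 1, each later return lowers |L| by at
most ‖T₀‖ + 1, so `hrT` keeps |L| ≥ 1 through `n` returns. -/
theorem exists_return_iterate_of_tendsto (hs : Tendsto s l (cobounded ℂ))
    (hd : Tendsto d l (𝓝 d₀)) (hq : continuant d₀ (j + 2) = 0)
    (hc : ∀ i, 0 < i → i < j + 2 → continuant d₀ i ≠ 0) {T₀ : ℂ}
    (hT : Tendsto (fun k => s k * continuant (d k) (j + 2) / continuant d₀ (j + 1)) l (𝓝 T₀))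
    {L₀ : ℂ} (hy : Tendsto y l (𝓝 L₀)) {n : ℕ} {r : ℝ} (hr : 0 < r)
    (hrT : 2 + n * (‖T₀‖ + 1) ≤ r⁻¹) (hL : ‖L₀‖ = r) (m : ℕ) (hm : m ≤ n) :
    ∃ (z : ι → ℂ) (L : ℂ), L ≠ 0 ∧ Tendsto z l (𝓝 L) ∧
      (∀ᶠ k in l, (F (s k ^ 2) (s k * d k))^[(j + 2) * m] (y k : OnePoint ℂ) = z k) ∧
      (m = 0 → ‖L‖ = r) ∧ (0 < m → r⁻¹ - 1 - m * (‖T₀‖ + 1) ≤ ‖L‖) := by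
  induction m with
  | zero =>
    refine ⟨y, L₀, norm_pos_iff.1 (hL ▸ hr), hy, Eventually.of_forall fun k => rfl,
      fun _ => hL, fun h => absurd h (lt_irrefl 0)⟩
  | succ m ih =>
    obtain ⟨z, L, hL0, hz, hzk, h0, hpos⟩ := ih (by omega)
    obtain ⟨z', κ, μ, η, hκ, hμ, hη, hz'k, hz'⟩ := exists_return_map hs hd (hz.eventually_ne hL0)
      (tendsto_add_inv_div_zero hs hL0 hz) hq hc
    have hlim := ((hκ.mul hT).add (hμ.mul (hz.add (hz.inv₀ hL0)))).add hη
    rw [one_mul, one_mul, add_zero] at hlim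
    have hm1 : (m : ℝ) + 1 ≤ n := by exact_mod_cast hm
    have hT0 := norm_nonneg T₀
    have hbound : r⁻¹ - 1 - ((m + 1 : ℕ) : ℝ) * (‖T₀‖ + 1) ≤ ‖T₀ + (L + L⁻¹)‖ := by
      push_cast
      rcases Nat.eq_zero_or_pos m with rfl | hmpos
      · have hLr := h0 rfl
        have h1 := norm_sub_le (T₀ + (L + L⁻¹)) (T₀ + L)
        have h2 := norm_add_le T₀ L
        rw [show T₀ + (L + L⁻¹) - (T₀ + L) = L⁻¹ by ring, norm_inv, hLr] at h1
        have h3 : r ≤ 1 := by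
          refine (one_le_inv₀ hr).1 ?_
          nlinarith
        simp only [Nat.cast_zero, zero_add, one_mul]
        linarith
      · have hLm := hpos hmpos
        have hL1 : 1 ≤ ‖L‖ := by nlinarith
        have hLinv : ‖L⁻¹‖ ≤ 1 := by
          rw [norm_inv]
          exact inv_le_one_of_one_le₀ hL1
        have h1 := norm_sub_le (T₀ + (L + L⁻¹)) (T₀ + L⁻¹)
        have h2 := norm_add_le T₀ L⁻¹
        rw [show T₀ + (L + L⁻¹) - (T₀ + L⁻¹) = L by ring] at h1
        linarith
    refine ⟨z', T₀ + (L + L⁻¹), ?_, hlim.congr' (hz'.mono fun k hk => hk.symm), ?_,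
      fun h => absurd h m.succ_ne_zero, fun _ => hbound⟩
    · refine norm_pos_iff.1 (lt_of_lt_of_le ?_ hbound)
      push_cast
      nlinarith
    · filter_upwards [hzk, hz'k] with k hk hk'
      rw [mul_add, mul_one, add_comm, Function.iterate_add_apply, hk, hk']

/-- Each return adds about `T`, so the m-th is asymptotic to mT for m > 0. It remains o(s) because
T/s is proportional to K_q(d) → 0, so the return map applies again. -/
theorem exists_return_iterate_of_cobounded (hs : Tendsto s l (cobounded ℂ))
    (hd : Tendsto d l (𝓝 d₀)) (hq : continuant d₀ (j + 2) = 0)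
    (hc : ∀ i, 0 < i → i < j + 2 → continuant d₀ i ≠ 0)
    (hT : Tendsto (fun k => s k * continuant (d k) (j + 2) / continuant d₀ (j + 1)) l (cobounded ℂ))
    {L₀ : ℂ} (hy : Tendsto y l (𝓝 L₀)) (hL : L₀ ≠ 0) (m : ℕ) :
    ∃ z : ι → ℂ, (∀ᶠ k in l, z k ≠ 0) ∧
      Tendsto (fun k => (z k + (z k)⁻¹) / s k) l (𝓝 0) ∧
      Tendsto (fun k => (z k + (z k)⁻¹) / (s k * continuant (d k) (j + 2) / continuant d₀ (j + 1)))
        l (𝓝 m) ∧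
      (∀ᶠ k in l, (F (s k ^ 2) (s k * d k))^[(j + 2) * m] (y k : OnePoint ℂ) = z k) ∧
      (0 < m → Tendsto z l (cobounded ℂ)) := by
  set T : ι → ℂ := fun k => s k * continuant (d k) (j + 2) / continuant d₀ (j + 1) with hTdef
  have hT0 : ∀ᶠ k in l, T k ≠ 0 := hT.eventually (eventually_ne_cobounded 0)
  have hs0 : ∀ᶠ k in l, s k ≠ 0 := hs.eventually (eventually_ne_cobounded 0)
  have hTs : Tendsto (fun k => T k / s k) l (𝓝 0) := by
    have h1 := (((continuous_continuant (j + 2)).tendsto d₀).comp hd).div_const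
      (continuant d₀ (j + 1))
    rw [hq, zero_div] at h1
    refine h1.congr' ?_
    filter_upwards [hs0] with k hk
    simp only [hTdef, Function.comp_apply]
    field_simp
  induction m with
  | zero =>
    refine ⟨y, hy.eventually_ne hL, tendsto_add_inv_div_zero hs hL hy, ?_,
      Eventually.of_forall fun k => rfl, fun h => absurd h (lt_irrefl 0)⟩
    rw [Nat.cast_zero]
    exact tendsto_add_inv_div_zero hT hL hy
  | succ m ih =>
    obtain ⟨z, hz0, hu, hzT, hzk, -⟩ := ih
    obtain ⟨z', κ, μ, η, hκ, hμ, hη, hz'k, hz'⟩ := exists_return_map hs hd hz0 hu hq hc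
    have hTinv : Tendsto (fun k => (T k)⁻¹) l (𝓝 0) := tendsto_inv₀_cobounded.comp hT
    have hz'T : Tendsto (fun k => z' k / T k) l (𝓝 ((m + 1 : ℕ) : ℂ)) := by
      replace hzT : Tendsto (fun k => (z k + (z k)⁻¹) / T k) l (𝓝 m) := hzT
      have hlim := (hκ.add (hμ.mul hzT)).add (hη.mul hTinv)
      rw [one_mul, mul_zero, add_zero, add_comm (1 : ℂ), ← Nat.cast_add_one] at hlim
      refine hlim.congr' ?_
      filter_upwards [hz', hT0] with k hk hTk
      rw [hk]
      change _ = (κ k * T k + μ k * (z k + (z k)⁻¹) + η k) / T k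
      field_simp
    have hcob : Tendsto z' l (cobounded ℂ) := by
      rw [← tendsto_norm_atTop_iff_cobounded] at hT ⊢
      have hpos : 0 < ‖((m + 1 : ℕ) : ℂ)‖ := norm_pos_iff.2 (Nat.cast_ne_zero.2 m.succ_ne_zero)
      refine (hz'T.norm.pos_mul_atTop hpos hT).congr' ?_
      filter_upwards [hT0] with k hTk
      rw [← norm_mul, div_mul_cancel₀ _ hTk]
    have hzinv : Tendsto (fun k => (z' k)⁻¹) l (𝓝 0) := tendsto_inv₀_cobounded.comp hcob
    have hsum : Tendsto (fun k => (z' k + (z' k)⁻¹) / T k) l (𝓝 ((m + 1 : ℕ) : ℂ)) := by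
      have := hz'T.add (hzinv.mul hTinv)
      rw [mul_zero, add_zero] at this
      refine this.congr fun k => ?_
      rw [add_div, div_eq_mul_inv (z' k)⁻¹]
    refine ⟨z', hcob.eventually (eventually_ne_cobounded 0), ?_, hsum, ?_, fun _ => hcob⟩
    · have := hsum.mul hTs
      rw [mul_zero] at this
      refine this.congr' ?_
      filter_upwards [hT0] with k hTk
      rw [div_mul_div_cancel₀ hTk]
    · filter_upwards [hzk, hz'k] with k hk hk'
      rw [mul_add, mul_one, add_comm, Function.iterate_add_apply, hk, hk']

end Return

/-! ### Choice of the radius along an ultrafilter -/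

theorem ultrafilter_tendsto_nhds_or_cobounded {ι : Type*} (𝒰 : Ultrafilter ι) (f : ι → ℂ) :
    (∃ a, Tendsto f 𝒰 (𝓝 a)) ∨ Tendsto f 𝒰 (cobounded ℂ) := by
  by_cases h : ∃ R, ∀ᶠ k in (𝒰 : Filter ι), ‖f k‖ ≤ R
  · obtain ⟨R, hR⟩ := h
    obtain ⟨a, -, ha⟩ := (isCompact_closedBall (0 : ℂ) R).ultrafilter_le_nhds (𝒰.map f)
      (le_principal_iff.2 (hR.mono fun k hk => mem_closedBall_zero_iff.2 hk))
    exact Or.inl ⟨a, ha⟩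
  · push Not at h
    refine Or.inr (tendsto_norm_atTop_iff_cobounded.1 (tendsto_atTop.2 fun R => ?_))
    exact (h R).mono fun k hk => hk.le

theorem exists_radius_escape {ι : Type*} (𝒰 : Ultrafilter ι) {s d : ι → ℂ} {d₀ : ℂ}
    (hs : Tendsto s 𝒰 (cobounded ℂ)) (hd : Tendsto d 𝒰 (𝓝 d₀)) {n : ℕ} (hn : 0 < n) {R : ℝ}
    (hR : 0 < R) :
    ∃ r, 0 < r ∧ r ≤ R ∧ ∀ y : ι → ℂ, (∀ k, ‖y k‖ = r) →
      ∀ᶠ k in (𝒰 : Filter ι), ∀ v : ℂ, ‖v‖ ≤ r →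
        (F (s k ^ 2) (s k * d k))^[n] (y k : OnePoint ℂ) ≠ v := by
  have hlimit : ∀ (r : ℝ) (y : ι → ℂ), (∀ k, ‖y k‖ = r) →
      ∃ L₀, ‖L₀‖ = r ∧ Tendsto y 𝒰 (𝓝 L₀) := by
    intro r y hy
    have hmem : ∀ᶠ k in (𝒰 : Filter ι), y k ∈ Metric.sphere (0 : ℂ) r :=
      Eventually.of_forall fun k => mem_sphere_zero_iff_norm.2 (hy k)
    obtain ⟨a, ha, hya⟩ := (isCompact_sphere (0 : ℂ) r).ultrafilter_le_nhds (𝒰.map y)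
      (le_principal_iff.2 hmem)
    exact ⟨a, mem_sphere_zero_iff_norm.1 ha, hya⟩
  by_cases hper : ∃ q, 0 < q ∧ continuant d₀ q = 0
  · classical
    obtain ⟨hq0, hq⟩ := Nat.find_spec hper
    have hc : ∀ i, 0 < i → i < Nat.find hper → continuant d₀ i ≠ 0 := fun i hi hiq h0 =>
      Nat.find_min hper hiq ⟨hi, h0⟩
    have hq1 : Nat.find hper ≠ 1 := by
      intro h
      rw [h] at hq
      exact one_ne_zero hq
    obtain ⟨j, hj⟩ : ∃ j, Nat.find hper = j + 2 := ⟨Nat.find hper - 2, by omega⟩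
    rw [hj] at hq hc
    have hdiv := Nat.mod_add_div n (j + 2)
    have hmod := Nat.mod_lt n (show 0 < j + 2 by omega)
    -- Here `z` is the orbit after ⌊n/q⌋ returns. Any n mod q > 0 further steps escape since the
    -- continuants below `q` do not vanish; otherwise `z` itself must lie outside the disc.
    have hfinish : ∀ (y z : ι → ℂ) (r : ℝ), (∀ᶠ k in (𝒰 : Filter ι), z k ≠ 0) →
        Tendsto (fun k => (z k + (z k)⁻¹) / s k) 𝒰 (𝓝 0) →
        (∀ᶠ k in (𝒰 : Filter ι),
          (F (s k ^ 2) (s k * d k))^[(j + 2) * (n / (j + 2))] (y k : OnePoint ℂ) = z k) →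
        (n % (j + 2) = 0 → ∀ᶠ k in (𝒰 : Filter ι), r < ‖z k‖) →
        ∀ᶠ k in (𝒰 : Filter ι), ∀ v : ℂ, ‖v‖ ≤ r →
          (F (s k ^ 2) (s k * d k))^[n] (y k : OnePoint ℂ) ≠ v := by
      intro y z r hz hu hzk hzr
      rcases Nat.eq_zero_or_pos (n % (j + 2)) with h0 | hpos
      · rw [h0, zero_add] at hdiv
        rw [hdiv] at hzk
        filter_upwards [hzk, hzr h0] with k hk hkr v hv hkv
        rw [hk, OnePoint.coe_eq_coe] at hkv
        rw [hkv] at hkr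
        linarith
      · filter_upwards [hzk, escape_of_continuant_ne_zero hs hd hz hu hpos
          (fun i hi hin => hc i hi (by omega)) r] with k hk hkesc v hv
        rw [← hdiv, Function.iterate_add_apply, hk]
        exact hkesc v hv
    have hmpos : n % (j + 2) = 0 → 0 < n / (j + 2) := fun h0 => by
      rcases Nat.eq_zero_or_pos (n / (j + 2)) with h | h
      · rw [h0, h] at hdiv
        omega
      · exact h
    rcases ultrafilter_tendsto_nhds_or_cobounded 𝒰
      (fun k => s k * continuant (d k) (j + 2) / continuant d₀ (j + 1)) with ⟨T₀, hT⟩ | hT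
    · have hA : 0 < 2 + n * (‖T₀‖ + 1) := by positivity
      refine ⟨min R (2 + n * (‖T₀‖ + 1))⁻¹, lt_min hR (inv_pos.2 hA), min_le_left _ _,
        fun y hy => ?_⟩
      set r := min R (2 + n * (‖T₀‖ + 1))⁻¹ with hr
      have hr0 : 0 < r := lt_min hR (inv_pos.2 hA)
      have hrT : 2 + n * (‖T₀‖ + 1) ≤ r⁻¹ := (le_inv_comm₀ hA hr0).2 (min_le_right _ _)
      obtain ⟨L₀, hL₀, hyL⟩ := hlimit r y hy
      have hmn := Nat.div_le_self n (j + 2)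
      obtain ⟨z, L, hL, hz, hzk, -, hpos⟩ :=
        exists_return_iterate_of_tendsto hs hd hq hc hT hyL hr0 hrT hL₀ (n / (j + 2)) hmn
      refine hfinish y z r (hz.eventually_ne hL) (tendsto_add_inv_div_zero hs hL hz) hzk fun h0 => ?_
      have hb := hpos (hmpos h0)
      have hmn' : ((n / (j + 2) : ℕ) : ℝ) ≤ n := by exact_mod_cast hmn
      have hL1 : 1 ≤ ‖L‖ := by nlinarith [norm_nonneg T₀]
      have hr1 : r < 1 := by
        refine (one_lt_inv₀ hr0).1 (lt_of_lt_of_le ?_ hrT)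
        have : 0 ≤ n * (‖T₀‖ + 1) := by positivity
        linarith
      exact hz.norm.eventually_const_lt (hr1.trans_le hL1)
    · refine ⟨R, hR, le_rfl, fun y hy => ?_⟩
      obtain ⟨L₀, hL₀, hyL⟩ := hlimit R y hy
      have hL0 : L₀ ≠ 0 := norm_pos_iff.1 (hL₀ ▸ hR)
      obtain ⟨z, hz0, hu, -, hzk, hcob⟩ :=
        exists_return_iterate_of_cobounded hs hd hq hc hT hyL hL0 (n / (j + 2))
      exact hfinish y z R hz0 hu hzk fun h0 =>
        (tendsto_norm_atTop_iff_cobounded.2 (hcob (hmpos h0))).eventually_gt_atTop R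
  · push Not at hper
    refine ⟨R, hR, le_rfl, fun y hy => ?_⟩
    obtain ⟨L₀, hL₀, hyL⟩ := hlimit R y hy
    have hL0 : L₀ ≠ 0 := norm_pos_iff.1 (hL₀ ▸ hR)
    exact escape_of_continuant_ne_zero hs hd (hyL.eventually_ne hL0)
      (tendsto_add_inv_div_zero hs hL0 hyL) hn (fun i hi _ => hper i hi) R

/-- Uniformity over the circle follows by choosing, for each `k`, a non-escaping point whenever one
exists. -/
theorem exists_radius_eventually_escape {ι : Type*} (𝒰 : Ultrafilter ι) {s d : ι → ℂ} {d₀ : ℂ}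
    (hs : Tendsto s 𝒰 (cobounded ℂ)) (hd : Tendsto d 𝒰 (𝓝 d₀)) {n : ℕ} (hn : 0 < n) {R : ℝ}
    (hR : 0 < R) :
    ∃ r, 0 < r ∧ r ≤ R ∧ ∀ᶠ k in (𝒰 : Filter ι), ∀ y v : ℂ, ‖y‖ = r → ‖v‖ ≤ r →
      (F (s k ^ 2) (s k * d k))^[n] (y : OnePoint ℂ) ≠ v := by
  obtain ⟨r, hr, hrR, hesc⟩ := exists_radius_escape 𝒰 hs hd hn hR
  refine ⟨r, hr, hrR, ?_⟩
  have hchoice : ∀ k, ∃ y : ℂ, ‖y‖ = r ∧ ((∀ v : ℂ, ‖v‖ ≤ r →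
      (F (s k ^ 2) (s k * d k))^[n] (y : OnePoint ℂ) ≠ v) → ∀ y' v : ℂ, ‖y'‖ = r → ‖v‖ ≤ r →
      (F (s k ^ 2) (s k * d k))^[n] (y' : OnePoint ℂ) ≠ v) := by
    intro k
    by_cases h : ∃ y v : ℂ, ‖y‖ = r ∧ ‖v‖ ≤ r ∧
        (F (s k ^ 2) (s k * d k))^[n] (y : OnePoint ℂ) = v
    · obtain ⟨y, v, hy, hv, hyv⟩ := h
      exact ⟨y, hy, fun hno => absurd hyv (hno v hv)⟩
    · push Not at h
      exact ⟨r, by simp [abs_of_pos hr], fun _ => h⟩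
  choose y hy hyk using hchoice
  exact (hesc y hy).mono fun k hk => hyk k hk

/-! ### The two regimes combined -/

theorem immediateBasin_subset_of_ultrafilter (𝒰 : Ultrafilter ℕ) {γ δ : ℕ → ℂ}
    (hγ0 : ∀ k, γ k ≠ 0) (hγ : Tendsto (fun k => ‖γ k‖) 𝒰 atTop) {n : ℕ} (hn : 1 < n)
    {z : ℕ → OnePoint ℂ} (hattr : ∀ k, IsAttractingPeriodicPt (F (γ k) (δ k)) n (z k))
    (hz : Tendsto z 𝒰 (𝓝 ((0 : ℂ) : OnePoint ℂ))) {U : Set (OnePoint ℂ)}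
    (hU : U ∈ 𝓝 ((0 : ℂ) : OnePoint ℂ)) :
    ∀ᶠ k in (𝒰 : Filter ℕ), immediateBasin (F (γ k) (δ k)) (z k) ⊆ U := by
  obtain ⟨R, hR, hRU⟩ := Metric.nhds_basis_closedBall.mem_iff.1
    (OnePoint.continuous_coe.continuousAt.preimage_mem_nhds hU)
  have hsub : ∀ r ≤ R, ((↑) : ℂ → OnePoint ℂ) '' Metric.closedBall (0 : ℂ) r ⊆ U := fun r hr =>
    Set.image_subset_iff.2 ((Metric.closedBall_subset_closedBall hr).trans hRU)
  have hzsmall : ∀ r : ℝ, 0 < r → ∀ᶠ k in (𝒰 : Filter ℕ), ∃ w : ℂ, ‖w‖ ≤ r ∧ z k = w := by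
    intro r hr
    filter_upwards [hz (OnePoint.isOpenEmbedding_coe.isOpenMap.image_mem_nhds
      (Metric.closedBall_mem_nhds (0 : ℂ) hr))] with k hk
    obtain ⟨w, hw, hwk⟩ := hk
    exact ⟨w, mem_closedBall_zero_iff.1 hw, hwk.symm⟩
  choose s hs2 using fun k => IsAlgClosed.exists_pow_nat_eq (γ k) (show 0 < 2 by norm_num)
  have hs0 : ∀ k, s k ≠ 0 := fun k h => hγ0 k (by rw [← hs2, h]; norm_num)
  have hs : Tendsto s 𝒰 (cobounded ℂ) := by
    rw [← tendsto_norm_atTop_iff_cobounded]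
    have h1 := Real.tendsto_sqrt_atTop.comp hγ
    refine h1.congr fun k => ?_
    rw [Function.comp_apply, ← hs2, norm_pow, Real.sqrt_sq (norm_nonneg _)]
  have hδ : ∀ k, s k * (δ k / s k) = δ k := fun k => mul_div_cancel₀ (δ k) (hs0 k)
  rcases ultrafilter_tendsto_nhds_or_cobounded 𝒰 (fun k => δ k / s k) with ⟨d₀, hd⟩ | hd
  · obtain ⟨r, hr, hrR, hesc⟩ := exists_radius_eventually_escape 𝒰 hs hd (by omega : 0 < n) hR
    filter_upwards [hesc, hzsmall r hr] with k hk hzk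
    obtain ⟨w, hw, hwk⟩ := hzk
    rw [hs2, hδ] at hk
    have hak := hattr k
    rw [hwk] at hak ⊢
    exact (immediateBasin_subset_closedBall (hγ0 k) hak hw hk).trans (hsub r hrR)
  · have hdn : Tendsto (fun k => ‖δ k / s k‖) 𝒰 atTop := tendsto_norm_atTop_iff_cobounded.2 hd
    have hsn : Tendsto (fun k => ‖s k‖) 𝒰 atTop := tendsto_norm_atTop_iff_cobounded.2 hs
    -- The bound |δ| ≥ 3|s| gives |δ|² ≥ 9|γ| ≥ 8|γ|; |s| ≥ 4 puts `w` within |δ|/4, and |s| ≥ 4/R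
    -- gives 4/|δ| ≤ R.
    filter_upwards [hγ.eventually_ge_atTop 36, hdn.eventually_ge_atTop 3,
      hsn.eventually_ge_atTop (4 / R), hsn.eventually_ge_atTop 4, hzsmall 1 one_pos]
      with k hγk hdk hsR hs4 hzk
    obtain ⟨w, hw, hwk⟩ := hzk
    have hδk : ‖δ k‖ = ‖s k‖ * ‖δ k / s k‖ := by rw [← norm_mul, hδ]
    have hγs : ‖γ k‖ = ‖s k‖ ^ 2 := by rw [← hs2, norm_pow]
    have hle : ‖s k‖ * 3 ≤ ‖δ k‖ := by
      rw [hδk]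
      exact mul_le_mul_of_nonneg_left hdk (norm_nonneg _)
    have hδpos : 0 < ‖δ k‖ := by linarith
    have hak := hattr k
    rw [hwk] at hak ⊢
    refine (immediateBasin_subset_of_large hn hγk hδpos ?_ (by linarith) hak).trans (hsub _ ?_)
    · rw [hγs]
      nlinarith
    · rw [div_le_iff₀ hδpos, mul_comm, ← div_le_iff₀ hR]
      linarith

end QuadRat

theorem mainTheorem7 (γ δ : ℕ → ℂ) (hγ0 : ∀ k, γ k ≠ 0)
    (hγ : Tendsto (fun k => ‖γ k‖) atTop atTop)
    (n : ℕ) (hn : 1 < n) (z : ℕ → OnePoint ℂ)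
    (hattr : ∀ k, QuadRat.IsAttractingPeriodicPt (QuadRat.F (γ k) (δ k)) n (z k))
    (hz : Tendsto z atTop (𝓝 ((0 : ℂ) : OnePoint ℂ))) :
    ∀ U ∈ 𝓝 ((0 : ℂ) : OnePoint ℂ),
      ∀ᶠ k in atTop, QuadRat.immediateBasin (QuadRat.F (γ k) (δ k)) (z k) ⊆ U := by
  intro U hU
  rw [eventually_iff, mem_iff_ultrafilter]
  exact fun 𝒰 h𝒰 => QuadRat.immediateBasin_subset_of_ultrafilter 𝒰 hγ0 (hγ.mono_left h𝒰) hn hattr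
    (hz.mono_left h𝒰) hU
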